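/- **Theorem.** For $z\in\mathbb C$ let $$\langle z\rangle=\Big\lfloor\tfrac{\operatorname{Re}z+\operatorname{Im}z+1}{2}\Big\rfloor(1+i)+\Big\lfloor\tfrac{\operatorname{Re}z-\operatorname{Im}z+1}{2}\Big\rfloor(1-i)$$ (the nearest Gaussian integer $x+yi$ with $x+y$ even), and let $K=\overline{\{z-\langle z\rangle : z\in\mathbb C\}}$, which is the diamond $|\operatorname{Re}z|+|\operatorname{Im}z|\le 1$. Let $\overline{\mathbb C}=\mathbb C\cup\{\infty\}$ be the extended complex plane, $S(z)=-1/z$ and $T^a(z)=z+a$ for $a\in\mathbb Z[i]$, acting on $\overline{\mathbb C}$, and let $$\hat G(z,w)=(T^{-a}Sz,\;T^{-a}Sw),\qquad a=\langle Sz\rangle ,$$ for $z\in\mathbb C\setminus\{0\}$ and $w\in\overline{\mathbb C}$ (the values at $z=0$ form a null set and are immaterial). Define $$K_1=\Big\{z\in K:\ \big|z-\tfrac{-1+i}{2}\big|\le\tfrac1{\sqrt2},\ \big|z-\tfrac{-1-i}{2}\big|\le\tfrac1{\sqrt2}\Big\},$$ $$K_2=\Big\{z\in K:\ \big|z-\tfrac{-1+i}{2}\big|\le\tfrac1{\sqrt2},\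 \big|z-\tfrac{-1-i}{2}\big|\ge\tfrac1{\sqrt2},\ \big|z-\tfrac{1+i}{2}\big|\ge\tfrac1{\sqrt2}\Big\},$$ and $K_j=-i\,K_{j-2}$ for $j=3,\dots,8$. With $B(c)=\{w\in\mathbb C:|w-c|<1\}$, define $$L_1=\overline{\mathbb C}\setminus\big(B(0)\cup B(-1+i)\cup B(-1-i)\big),\qquad L_2=\overline{\mathbb C}\setminus\big(B(0)\cup B(-1+i)\big),$$ and $L_j=-i\,L_{j-2}$ for $j=3,\dots,8$. Then $\hat G$ is bijective almost everywhere on $\Omega=\bigcup_{j=1}^{8}K_j\times L_j$: there are subsets $A,B\subseteq\Omega$ such that $\Omega\setminus A$ and $\Omega\setminus B$ have Lebesgue measure zero (the set $\mathbb C\times\{\infty\}$ being null) and $\hat G$ maps $A$ bijectively onto $B$. -/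

import Mathlib

namespace ComplexCF

open Complex MeasureTheory

noncomputable section

/-- The extended complex plane. -/
abbrev ExtC : Type := OnePoint ℂ

/-- The fundamental set of a choice function: the closure of the set of all `z - ⟨z⟩`. -/
def fundamentalSet (ch : ℂ → GaussianInt) : Set ℂ :=
  closure {u : ℂ | ∃ z : ℂ, u = z - (ch z : ℂ)}

/-- The inversion `S w = -1/w` of the extended plane, with `S 0 = ∞` and `S ∞ = 0`. -/
def S (w : ExtC) : ExtC :=
  w.elim ((0 : ℂ) : ExtC) (fun v => if v = 0 then OnePoint.infty else ((-1 / v : ℂ) : ExtC))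

/-- The translation `T^a w = w + a` of the extended plane, with `T^a ∞ = ∞`. -/
def T (a : GaussianInt) (w : ExtC) : ExtC :=
  OnePoint.map (fun v : ℂ => v + (a : ℂ)) w

/-- The digit `a = ⟨-1/z⟩` (only meaningful for `z ≠ 0`). -/
def digit (ch : ℂ → GaussianInt) (z : ℂ) : GaussianInt := ch (-1 / z)

/-- The Gauss map `G z = -1/z - ⟨-1/z⟩` for `z ≠ 0`, and `G 0 = 0`. -/
def gaussMap (ch : ℂ → GaussianInt) (z : ℂ) : ℂ :=
  if z = 0 then 0 else -1 / z - (digit ch z : ℂ)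

/-- The natural extension `(z, w) ↦ (T^{-a} S z, T^{-a} S w)` of the Gauss map, where
`a = ⟨S z⟩`. The second coordinate ranges over the extended plane. -/
def natExt (ch : ℂ → GaussianInt) (p : ℂ × ExtC) : ℂ × ExtC :=
  (gaussMap ch p.1, T (-digit ch p.1) (S p.2))

/-- Sets of Lebesgue measure zero in `ℂ × ExtC` (the point at infinity is negligible): the
part of `N` lying in `ℂ × ℂ` is a null set for Lebesgue measure. -/
def IsNull (N : Set (ℂ × ExtC)) : Prop :=
  volume {p : ℂ × ℂ | (p.1, (p.2 : ExtC)) ∈ N} = 0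

/-- `F` is bijective almost everywhere on `Ω`: after discarding null subsets of `Ω` from the
source and from the target, `F` is a bijection from `Ω` to `Ω`. -/
def BijectiveAEOn (F : ℂ × ExtC → ℂ × ExtC) (Ω : Set (ℂ × ExtC)) : Prop :=
  ∃ A B : Set (ℂ × ExtC), A ⊆ Ω ∧ B ⊆ Ω ∧ IsNull (Ω \ A) ∧ IsNull (Ω \ B) ∧ Set.BijOn F A B

/-- The nearest even choice function
`⟨z⟩ = ⌊(Re z + Im z + 1)/2⌋ (1 + i) + ⌊(Re z - Im z + 1)/2⌋ (1 - i)`. -/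
def nearestEven (z : ℂ) : GaussianInt :=
  (⌊(z.re + z.im + 1) / 2⌋ : GaussianInt) * ⟨1, 1⟩
    + (⌊(z.re - z.im + 1) / 2⌋ : GaussianInt) * ⟨1, -1⟩

/-- The pieces `K_1, …, K_8` of the fundamental set of the nearest even algorithm, where
`K_i = -i K_{i-2}` for `i ≥ 3` (the value at index `0` is not used). -/
def K : ℕ → Set ℂ
  | 0 => ∅
  | 1 => {z | z ∈ fundamentalSet nearestEven ∧
      ‖z - (-1 + I) / 2‖ ≤ 1 / √2 ∧ ‖z - (-1 - I) / 2‖ ≤ 1 / √2}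
  | 2 => {z | z ∈ fundamentalSet nearestEven ∧
      ‖z - (-1 + I) / 2‖ ≤ 1 / √2 ∧ ‖z - (-1 - I) / 2‖ ≥ 1 / √2 ∧
      ‖z - (1 + I) / 2‖ ≥ 1 / √2}
  | (i + 3) => (fun z : ℂ => -I * z) '' K (i + 1)

/-- The open unit disk with center `c`, as a subset of the extended plane. -/
def B (c : ℂ) : Set ExtC := (fun w : ℂ => (w : ExtC)) '' Metric.ball c 1

/-- The sets `L_1, …, L_8` in the extended plane, where `L_i = -i L_{i-2}` for `i ≥ 3`
(the value at index `0` is not used). -/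
def L : ℕ → Set ExtC
  | 0 => ∅
  | 1 => Set.univ \ (B 0 ∪ B (-1 + I) ∪ B (-1 - I))
  | 2 => Set.univ \ (B 0 ∪ B (-1 + I))
  | (i + 3) => OnePoint.map (fun w : ℂ => -I * w) '' L (i + 1)

end

end ComplexCF

namespace ComplexCF

open Complex MeasureTheory

noncomputable section

/-! In the basis 1 + i, 1 - i the even Gaussian integers become ℤ², K becomes the unit square
centred at 0, and the unit disks in the L_j become disks of squared radius 1/2 about 0 and its four
lattice neighbours ±e₁, ±e₂. Up to boundaries, the eight products K_j × L_j merge into one rule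
(`InnerRegion`): z is in the square, w is outside the disk about 0, and w is outside the disk about
a neighbour e whenever z lies in the disk having the side towards e as diameter.

Applying S to both variables turns this region into `OuterRegion`, where z avoids the four side
disks and w lies in the disk about 0. The preimages of (z, w) in Ω are therefore the points (S(z +
a), S(w + a)) with a in the lattice and (z + a, w + a) outer. So, for generic (z, w) with z in the
square, it must be shown that an outer translate exists only if (z, w) is inner
(`OuterRegion.innerRegion`), that it is unique (`OuterRegion.int_unique`), and that it exists if (z,
w) is inner (`InnerRegion.exists_outerRegion`). For existence, take a of least ℓ¹ norm among those
bringing w into the disk about 0.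

Genericity means avoiding countably many lines, circles and points in each variable, so it holds
almost everywhere. -/

/-! ### The two regions and the inversion between them. -/

/-- The region `Ω` in the coordinates `z = s (1 + i) + t (1 - i)`, `w = x (1 + i) + y (1 - i)`,
up to boundaries. -/
def InnerRegion (s t x y : ℝ) : Prop :=
  (s < 1 / 2 ∧ -s < 1 / 2 ∧ t < 1 / 2 ∧ -t < 1 / 2) ∧ 1 / 2 < x ^ 2 + y ^ 2 ∧
  (s ^ 2 + t ^ 2 < s → 1 / 2 < (x - 1) ^ 2 + y ^ 2) ∧
  (s ^ 2 + t ^ 2 < -s → 1 / 2 < (x + 1) ^ 2 + y ^ 2) ∧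
  (s ^ 2 + t ^ 2 < t → 1 / 2 < x ^ 2 + (y - 1) ^ 2) ∧
  (s ^ 2 + t ^ 2 < -t → 1 / 2 < x ^ 2 + (y + 1) ^ 2)

/-- The image of `InnerRegion` under the inversion `-1/·` in both variables. -/
def OuterRegion (s t x y : ℝ) : Prop :=
  (s < s ^ 2 + t ^ 2 ∧ -s < s ^ 2 + t ^ 2 ∧ t < s ^ 2 + t ^ 2 ∧ -t < s ^ 2 + t ^ 2) ∧
  x ^ 2 + y ^ 2 < 1 / 2 ∧
  (1 / 2 < s → 1 / 2 < (x - 1) ^ 2 + y ^ 2) ∧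
  (1 / 2 < -s → 1 / 2 < (x + 1) ^ 2 + y ^ 2) ∧
  (1 / 2 < t → 1 / 2 < x ^ 2 + (y - 1) ^ 2) ∧
  (1 / 2 < -t → 1 / 2 < x ^ 2 + (y + 1) ^ 2)

/-- Here S is (s, t) ↦ (-t, -s)/(2(s² + t²)). It exchanges the side lines of the square with the
four side circles through 0, and the inside with the outside of the unit circle. The unit circles
about the four neighbours, for which 0 has power 1, are permuted among themselves. -/
theorem innerRegion_inv_iff {s t x y : ℝ} (hr : 0 < s ^ 2 + t ^ 2) (hρ : 0 < x ^ 2 + y ^ 2) :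
    InnerRegion (-t / (2 * (s ^ 2 + t ^ 2))) (-s / (2 * (s ^ 2 + t ^ 2)))
      (-y / (2 * (x ^ 2 + y ^ 2))) (-x / (2 * (x ^ 2 + y ^ 2))) ↔ OuterRegion s t x y := by
  have e1 : ∀ a : ℝ, a / (2 * (s ^ 2 + t ^ 2)) < 1 / 2 ↔ a < s ^ 2 + t ^ 2 := fun a => by
    rw [div_lt_iff₀ (by positivity)]
    constructor <;> intro h <;> linarith
  have e2 : (-t / (2 * (s ^ 2 + t ^ 2))) ^ 2 + (-s / (2 * (s ^ 2 + t ^ 2))) ^ 2 =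
      1 / 2 / (2 * (s ^ 2 + t ^ 2)) := by
    field_simp
    ring
  have e3 : ∀ a : ℝ, 1 / 2 / (2 * (s ^ 2 + t ^ 2)) < a / (2 * (s ^ 2 + t ^ 2)) ↔ 1 / 2 < a :=
    fun a => div_lt_div_iff_of_pos_right (by positivity)
  have e4 : (1 / 2 < (-y / (2 * (x ^ 2 + y ^ 2))) ^ 2 + (-x / (2 * (x ^ 2 + y ^ 2))) ^ 2) ↔
      x ^ 2 + y ^ 2 < 1 / 2 := by
    have : (-y / (2 * (x ^ 2 + y ^ 2))) ^ 2 + (-x / (2 * (x ^ 2 + y ^ 2))) ^ 2 =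
      1 / (4 * (x ^ 2 + y ^ 2)) := by
      field_simp
      ring
    rw [this, lt_div_iff₀ (by positivity)]
    constructor <;> intro h <;> linarith
  have e5 : ∀ a b : ℝ, (1 / 2 < (-y / (2 * (x ^ 2 + y ^ 2)) + a) ^ 2 +
      (-x / (2 * (x ^ 2 + y ^ 2)) + b) ^ 2) ↔
      (x ^ 2 + y ^ 2) * (1 / 2 - (a ^ 2 + b ^ 2)) < 1 / 4 - a * y - b * x := fun a b => by
    have : (-y / (2 * (x ^ 2 + y ^ 2)) + a) ^ 2 + (-x / (2 * (x ^ 2 + y ^ 2)) + b) ^ 2 =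
      (a ^ 2 + b ^ 2) + (1 / 4 - a * y - b * x) / (x ^ 2 + y ^ 2) := by
      field_simp
      ring
    rw [this, ← sub_lt_iff_lt_add', lt_div_iff₀ hρ, mul_comm]
  have f1 := e5 (-1) 0
  have f2 := e5 1 0
  have f3 := e5 0 (-1)
  have f4 := e5 0 1
  simp only [add_zero, ← sub_eq_add_neg] at f1 f2 f3 f4
  unfold InnerRegion OuterRegion
  rw [e4, e2, f1, f2, f3, f4]
  simp only [← neg_div, e1, e3, neg_neg]
  have g1 : ((x ^ 2 + y ^ 2) * (1 / 2 - ((-1) ^ 2 + 0 ^ 2)) < 1 / 4 - (-1) * y - 0 * x) ↔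
    1 / 2 < x ^ 2 + (y + 1) ^ 2 := by constructor <;> intro h <;> nlinarith
  have g2 : ((x ^ 2 + y ^ 2) * (1 / 2 - (1 ^ 2 + 0 ^ 2)) < 1 / 4 - 1 * y - 0 * x) ↔
    1 / 2 < x ^ 2 + (y - 1) ^ 2 := by constructor <;> intro h <;> nlinarith
  have g3 : ((x ^ 2 + y ^ 2) * (1 / 2 - (0 ^ 2 + (-1) ^ 2)) < 1 / 4 - 0 * y - (-1) * x) ↔
    1 / 2 < (x + 1) ^ 2 + y ^ 2 := by constructor <;> intro h <;> nlinarith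
  have g4 : ((x ^ 2 + y ^ 2) * (1 / 2 - (0 ^ 2 + 1 ^ 2)) < 1 / 4 - 0 * y - 1 * x) ↔
    1 / 2 < (x - 1) ^ 2 + y ^ 2 := by constructor <;> intro h <;> nlinarith
  rw [g1, g2, g3, g4]
  constructor <;> rintro ⟨⟨h1, h2, h3, h4⟩, h5, h6, h7, h8, h9⟩ <;>
    exact ⟨⟨h4, h3, h2, h1⟩, h5, h9, h8, h7, h6⟩

/-! ### Lattice translates in the outer region. -/

/-- A point of the open disk of radius `1/√2` about the origin is outside the corresponding
closed disk about any lattice point other than the origin and its four neighbours. -/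
theorem lt_dist_sq_or_neighbour {x y : ℝ} (h : x ^ 2 + y ^ 2 < 1 / 2) (m n : ℤ) :
    1 / 2 < (x - m) ^ 2 + (y - n) ^ 2 ∨ (m = 0 ∧ n = 0) ∨ (m = 1 ∧ n = 0) ∨ (m = -1 ∧ n = 0) ∨
      (m = 0 ∧ n = 1) ∨ (m = 0 ∧ n = -1) := by
  -- A shift of at least 2 in one coordinate already suffices, as |u| < 3/4.
  have key : ∀ (u : ℝ) (k : ℤ), u ^ 2 < 1 / 2 → (2 ≤ k ∨ k ≤ -2) → 1 / 2 < (u - k) ^ 2 := by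
    rintro u k hu (hk | hk)
    · have hk' : (2 : ℝ) ≤ k := by exact_mod_cast hk
      nlinarith [show u < 3 / 4 by nlinarith]
    · have hk' : (k : ℝ) ≤ -2 := by exact_mod_cast hk
      nlinarith [show -u < 3 / 4 by nlinarith]
  by_cases hm : 2 ≤ m ∨ m ≤ -2
  · left
    nlinarith [key x m (by nlinarith) hm, sq_nonneg (y - n)]
  by_cases hn : 2 ≤ n ∨ n ≤ -2
  · left
    nlinarith [key y n (by nlinarith) hn, sq_nonneg (x - m)]
  obtain ⟨h1, h2⟩ : -1 ≤ m ∧ m ≤ 1 := by omega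
  obtain ⟨h3, h4⟩ : -1 ≤ n ∧ n ≤ 1 := by omega
  -- What remains are the diagonal points (±1, ±1): their disks are tangent to the one about 0, so
  -- the open disk misses the closed ones.
  interval_cases m <;> interval_cases n <;> simp <;>
    nlinarith [sq_nonneg (x - y), sq_nonneg (x + y), sq_nonneg (x + y - 1), sq_nonneg (x + y + 1),
      sq_nonneg (x - y - 1), sq_nonneg (x - y + 1)]

theorem half_lt_add_int {s : ℝ} (h2 : -s < 1 / 2) {m : ℤ} (hm : 1 ≤ m) :
    1 / 2 < s + m := by
  have : (1 : ℝ) ≤ m := by exact_mod_cast hm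
  linarith

theorem half_lt_neg_add_int {s : ℝ} (h1 : s < 1 / 2) {m : ℤ} (hm : m ≤ -1) :
    1 / 2 < -(s + m) := by
  have : (m : ℝ) ≤ -1 := by exact_mod_cast hm
  linarith

/-- The four open disks on the sides of a square through its centre cover the open square. -/
theorem false_of_lt_sq_add_sq {s t : ℝ} (hst : s < 1 / 2 ∧ -s < 1 / 2 ∧ t < 1 / 2 ∧ -t < 1 / 2)
    (h1 : s < s ^ 2 + t ^ 2) (h2 : -s < s ^ 2 + t ^ 2) (h3 : t < s ^ 2 + t ^ 2)
    (h4 : -t < s ^ 2 + t ^ 2) : False := by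
  obtain ⟨a1, a2, a3, a4⟩ := hst
  -- In the square, s² + t² ≤ (|s| + |t|)/2 ≤ max(|s|, |t|), against the four inequalities.
  rcases abs_cases s with ⟨hs, hs'⟩ | ⟨hs, hs'⟩ <;> rcases abs_cases t with ⟨ht, ht'⟩ | ⟨ht, ht'⟩ <;>
    nlinarith

theorem OuterRegion.int_ne_zero {s t x y : ℝ} {m n : ℤ}
    (hst : s < 1 / 2 ∧ -s < 1 / 2 ∧ t < 1 / 2 ∧ -t < 1 / 2)
    (h : OuterRegion (s + m) (t + n) (x + m) (y + n)) : ¬(m = 0 ∧ n = 0) := by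
  rintro ⟨rfl, rfl⟩
  obtain ⟨⟨h1, h2, h3, h4⟩, -⟩ := h
  simp only [Int.cast_zero, add_zero] at h1 h2 h3 h4
  exact false_of_lt_sq_add_sq hst h1 h2 h3 h4

/-- Write a = (m, n). As w + a is in the disk about 0, w + a - c is outside it for every lattice
point c other than 0 and its neighbours. A neighbour c towards which a has a positive component is
handled by the outer conditions. The inner conditions are the cases c = a and c = a ± eᵢ. -/
theorem OuterRegion.innerRegion {s t x y : ℝ} {m n : ℤ}
    (hst : s < 1 / 2 ∧ -s < 1 / 2 ∧ t < 1 / 2 ∧ -t < 1 / 2)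
    (h : OuterRegion (s + m) (t + n) (x + m) (y + n)) : InnerRegion s t x y := by
  have h0 := h.int_ne_zero hst
  obtain ⟨a1, a2, a3, a4⟩ := hst
  obtain ⟨⟨h1, h2, h3, h4⟩, hx, c1, c2, c3, c4⟩ := h
  -- With z in the open square, the half-plane conditions follow from the signs of m and n alone.
  replace c1 := fun hm : 1 ≤ m => c1 (half_lt_add_int a2 hm)
  replace c2 := fun hm : m ≤ -1 => c2 (half_lt_neg_add_int a1 hm)
  replace c3 := fun hm : 1 ≤ n => c3 (half_lt_add_int a4 hm)
  replace c4 := fun hm : n ≤ -1 => c4 (half_lt_neg_add_int a3 hm)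
  have key : ∀ k l : ℤ, ¬(k = 0 ∧ l = 0) → (k = 1 → l = 0 → 1 ≤ m) → (k = -1 → l = 0 → m ≤ -1) →
      (k = 0 → l = 1 → 1 ≤ n) → (k = 0 → l = -1 → n ≤ -1) →
      1 / 2 < (x + m - k) ^ 2 + (y + n - l) ^ 2 := by
    intro k l hkl g1 g2 g3 g4
    rcases lt_dist_sq_or_neighbour hx k l with h | h | ⟨rfl, rfl⟩ | ⟨rfl, rfl⟩ | ⟨rfl, rfl⟩ | ⟨rfl, rfl⟩
    · exact h
    · exact absurd h hkl
    · simpa using c1 (g1 rfl rfl)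
    · simpa using c2 (g2 rfl rfl)
    · simpa using c3 (g3 rfl rfl)
    · simpa using c4 (g4 rfl rfl)
  refine ⟨⟨a1, a2, a3, a4⟩, ?_, fun hr => ?_, fun hr => ?_, fun hr => ?_, fun hr => ?_⟩
  · have := key m n h0 (by omega) (by omega) (by omega) (by omega)
    simpa using this
  -- The excluded case c = 0 means a = -e₁; then z + a avoiding the side disk towards -e₁ says that
  -- z avoids the one towards e₁, against `hr`.
  · have := key (m + 1) n (by
      rintro ⟨hm, rfl⟩
      obtain rfl : m = -1 := by omega
      push_cast at h2
      nlinarith) (by omega) (by omega) (by omega) (by omega)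
    push_cast at this
    convert this using 2 <;> ring
  · have := key (m - 1) n (by
      rintro ⟨hm, rfl⟩
      obtain rfl : m = 1 := by omega
      push_cast at h1
      nlinarith) (by omega) (by omega) (by omega) (by omega)
    push_cast at this
    convert this using 2 <;> ring
  · have := key m (n + 1) (by
      rintro ⟨rfl, hm⟩
      obtain rfl : n = -1 := by omega
      push_cast at h4
      nlinarith) (by omega) (by omega) (by omega) (by omega)
    push_cast at this
    convert this using 2 <;> ring
  · have := key m (n - 1) (by
      rintro ⟨rfl, hm⟩
      obtain rfl : n = 1 := by omega
      push_cast at h3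
      nlinarith) (by omega) (by omega) (by omega) (by omega)
    push_cast at this
    convert this using 2 <;> ring

/-- Both translates of w lie in the disk about 0, so the two lattice points are equal or neighbours.
Of two neighbours, the one farther from the origin along their common axis has an outer condition
that pushes the other translate of w out of the disk. -/
theorem OuterRegion.int_unique {s t x y : ℝ} {m n k l : ℤ}
    (hst : s < 1 / 2 ∧ -s < 1 / 2 ∧ t < 1 / 2 ∧ -t < 1 / 2)
    (h : OuterRegion (s + m) (t + n) (x + m) (y + n))
    (h' : OuterRegion (s + k) (t + l) (x + k) (y + l)) : m = k ∧ n = l := by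
  obtain ⟨a1, a2, a3, a4⟩ := hst
  obtain ⟨-, hx, c1, c2, c3, c4⟩ := h
  obtain ⟨-, hx', d1, d2, d3, d4⟩ := h'
  replace c1 := fun hm : 1 ≤ m => c1 (half_lt_add_int a2 hm)
  replace c2 := fun hm : m ≤ -1 => c2 (half_lt_neg_add_int a1 hm)
  replace c3 := fun hm : 1 ≤ n => c3 (half_lt_add_int a4 hm)
  replace c4 := fun hm : n ≤ -1 => c4 (half_lt_neg_add_int a3 hm)
  replace d1 := fun hm : 1 ≤ k => d1 (half_lt_add_int a2 hm)
  replace d2 := fun hm : k ≤ -1 => d2 (half_lt_neg_add_int a1 hm)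
  replace d3 := fun hm : 1 ≤ l => d3 (half_lt_add_int a4 hm)
  replace d4 := fun hm : l ≤ -1 => d4 (half_lt_neg_add_int a3 hm)
  rcases lt_dist_sq_or_neighbour hx (m - k) (n - l) with h | h | h | h | h | h
  · push_cast at h
    ring_nf at h hx'
    linarith
  · omega
  · exfalso
    obtain ⟨rfl, rfl⟩ : m = k + 1 ∧ n = l := by omega
    rcases le_or_gt 0 k with hk | hk
    · have := c1 (by omega)
      push_cast at this
      ring_nf at this hx'
      linarith
    · have := d2 (by omega)
      push_cast at hx
      ring_nf at this hx
      linarith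
  · exfalso
    obtain ⟨rfl, rfl⟩ : k = m + 1 ∧ n = l := by omega
    rcases le_or_gt 0 m with hk | hk
    · have := d1 (by omega)
      push_cast at this
      ring_nf at this hx
      linarith
    · have := c2 (by omega)
      push_cast at hx'
      ring_nf at this hx'
      linarith
  · exfalso
    obtain ⟨rfl, rfl⟩ : m = k ∧ n = l + 1 := by omega
    rcases le_or_gt 0 l with hk | hk
    · have := c3 (by omega)
      push_cast at this
      ring_nf at this hx'
      linarith
    · have := d4 (by omega)
      push_cast at hx
      ring_nf at this hx
      linarith
  · exfalso
    obtain ⟨rfl, rfl⟩ : m = k ∧ l = n + 1 := by omega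
    rcases le_or_gt 0 n with hk | hk
    · have := d3 (by omega)
      push_cast at this
      ring_nf at this hx
      linarith
    · have := c4 (by omega)
      push_cast at hx'
      ring_nf at this hx'
      linarith

/-! ### Genericity and existence of an outer translate. -/

/-- No lattice translate of the point lies on a circle or line bounding the pieces of `Ω`
in the first coordinate, or on their images under inversion. -/
def FstGeneric (s t : ℝ) : Prop :=
  ∀ m n : ℤ, (s + m) ^ 2 + (t + n) ^ 2 ≠ s + m ∧ (s + m) ^ 2 + (t + n) ^ 2 ≠ -(s + m) ∧
    (s + m) ^ 2 + (t + n) ^ 2 ≠ t + n ∧ (s + m) ^ 2 + (t + n) ^ 2 ≠ -(t + n) ∧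
    s + m ≠ 1 / 2 ∧ t + n ≠ 1 / 2

/-- No lattice translate of the point is zero or lies on the unit circle. -/
def SndGeneric (x y : ℝ) : Prop :=
  ∀ m n : ℤ, (x + m) ^ 2 + (y + n) ^ 2 ≠ 1 / 2 ∧ (x + m) ^ 2 + (y + n) ^ 2 ≠ 0

/-- Minimality of |m| + |n| gives the outer conditions on w: if s + m > 1/2 then m ≥ 1, so (m - 1,
n) is shorter and cannot bring w into the disk. -/
theorem InnerRegion.exists_outerRegion {s t x y : ℝ} (hst : FstGeneric s t)
    (hxy : SndGeneric x y) (h : InnerRegion s t x y) :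
    ∃ m n : ℤ, OuterRegion (s + m) (t + n) (x + m) (y + n) := by
  have ex : ∃ N : ℕ, ∃ m n : ℤ, (x + m) ^ 2 + (y + n) ^ 2 < 1 / 2 ∧ m.natAbs + n.natAbs = N := by
    -- Rounding brings both coordinates within 1/2 of 0; genericity makes the inequality strict.
    refine ⟨_, -round x, -round y, lt_of_le_of_ne ?_ (hxy _ _).1, rfl⟩
    have h1 := abs_le.1 (abs_sub_round x)
    have h2 := abs_le.1 (abs_sub_round y)
    push_cast
    nlinarith
  classical
  obtain ⟨m, n, hx, hN⟩ := Nat.find_spec ex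
  have hmin : ∀ k l : ℤ, k.natAbs + l.natAbs < m.natAbs + n.natAbs →
      1 / 2 < (x + k) ^ 2 + (y + l) ^ 2 := fun k l hkl => by
    rw [hN] at hkl
    refine lt_of_le_of_ne (not_lt.1 fun hlt => Nat.find_min ex hkl ⟨k, l, hlt, rfl⟩) (hxy _ _).1.symm
  obtain ⟨⟨a1, a2, a3, a4⟩, b, b1, b2, b3, b4⟩ := h
  have sgn : ∀ {r : ℝ} {i : ℤ}, r < 1 / 2 → 1 / 2 < r + i → 1 ≤ i := fun {r i} hr hi => by
    have : (0 : ℝ) < i := by linarith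
    exact_mod_cast this
  have sgn' : ∀ {r : ℝ} {i : ℤ}, -r < 1 / 2 → 1 / 2 < -(r + i) → i ≤ -1 := fun {r i} hr hi => by
    have : (i : ℝ) < 0 := by linarith
    have : i < 0 := by exact_mod_cast this
    omega
  have h0 : ¬(m = 0 ∧ n = 0) := by
    rintro ⟨rfl, rfl⟩
    simp only [Int.cast_zero, add_zero] at hx
    linarith
  obtain ⟨g1, g2, g3, g4, -⟩ := hst 0 0
  simp only [Int.cast_zero, add_zero] at g1 g2 g3 g4
  -- A nonzero translate of the square meets the disk on the side towards e₁ only for the shift e₁,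
  -- where that disk is the translate of the one towards -e₁. The other three sides follow by
  -- swapping coordinates and changing signs.
  have circ : ∀ (u v : ℝ) (k l : ℤ), u < 1 / 2 → -u < 1 / 2 → v < 1 / 2 → -v < 1 / 2 →
      ¬(k = 0 ∧ l = 0) → (k = 1 → l = 0 → -u < u ^ 2 + v ^ 2) →
      u + k < (u + k) ^ 2 + (v + l) ^ 2 := by
    intro u v k l u1 u2 v1 v2 hkl hn
    rcases lt_trichotomy l 0 with hl | rfl | hl
    · have : (l : ℝ) ≤ -1 := by exact_mod_cast (by omega : l ≤ -1)
      nlinarith [sq_nonneg (u + k - 1 / 2)]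
    · rcases (by omega : k ≤ -1 ∨ k = 1 ∨ 2 ≤ k) with hk | rfl | hk
      · have : (k : ℝ) ≤ -1 := by exact_mod_cast hk
        nlinarith [sq_nonneg (v + (0 : ℤ))]
      · have := hn rfl rfl
        push_cast
        nlinarith
      · have : (2 : ℝ) ≤ k := by exact_mod_cast hk
        nlinarith [sq_nonneg (v + (0 : ℤ))]
    · have : (1 : ℝ) ≤ l := by exact_mod_cast (by omega : 1 ≤ l)
      nlinarith [sq_nonneg (u + k - 1 / 2)]
  refine ⟨m, n, ⟨?_, ?_, ?_, ?_⟩, hx, fun hs => ?_, fun hs => ?_, fun hs => ?_, fun hs => ?_⟩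
  · refine circ s t m n a1 a2 a3 a4 h0 ?_
    rintro rfl rfl
    refine lt_of_le_of_ne (not_lt.1 fun hlt => ?_) g2.symm
    have := b2 hlt
    push_cast at hx
    linarith
  · have := circ (-s) t (-m) n a2 (by linarith) a3 a4 (by omega) ?_
    · push_cast at this
      linarith
    intro hm hn
    obtain rfl : m = -1 := by omega
    subst hn
    refine lt_of_le_of_ne (not_lt.1 fun hlt => ?_) (fun h => g1 (by linarith))
    have := b1 (by linarith)
    push_cast at hx
    linarith
  · have := circ t s n m a3 a4 a1 a2 (by tauto) ?_
    · linarith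
    rintro rfl rfl
    refine lt_of_le_of_ne (not_lt.1 fun hlt => ?_) (fun h => g4 (by linarith))
    have := b4 (by linarith)
    push_cast at hx
    linarith
  · have := circ (-t) s (-n) m a4 (by linarith) a1 a2 (by omega) ?_
    · push_cast at this
      linarith
    intro hm hn
    obtain rfl : n = -1 := by omega
    subst hn
    refine lt_of_le_of_ne (not_lt.1 fun hlt => ?_) (fun h => g3 (by linarith))
    have := b3 (by linarith)
    push_cast at hx
    linarith
  · have := sgn a1 hs
    have := hmin (m - 1) n (by omega)
    push_cast at this
    convert this using 2; ring
  · have := sgn' a2 hs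
    have := hmin (m + 1) n (by omega)
    push_cast at this
    convert this using 2; ring
  · have := sgn a3 hs
    have := hmin m (n - 1) (by omega)
    push_cast at this
    convert this using 2; ring
  · have := sgn' a4 hs
    have := hmin m (n + 1) (by omega)
    push_cast at this
    convert this using 2; ring

/-! ### Coordinates on ℂ and the lattice. -/

/-- The coordinate of `z` along `1 + i` in the basis `1 + i, 1 - i`. -/
def fstCoord (z : ℂ) : ℝ := (z.re + z.im) / 2

/-- The coordinate of `z` along `1 - i` in the basis `1 + i, 1 - i`. -/
def sndCoord (z : ℂ) : ℝ := (z.re - z.im) / 2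

theorem fstCoord_add (z w : ℂ) : fstCoord (z + w) = fstCoord z + fstCoord w := by
  simp only [fstCoord, add_re, add_im]; ring

theorem sndCoord_add (z w : ℂ) : sndCoord (z + w) = sndCoord z + sndCoord w := by
  simp only [sndCoord, add_re, add_im]; ring

theorem fstCoord_sub (z w : ℂ) : fstCoord (z - w) = fstCoord z - fstCoord w := by
  simp only [fstCoord, sub_re, sub_im]; ring

theorem sndCoord_sub (z w : ℂ) : sndCoord (z - w) = sndCoord z - sndCoord w := by
  simp only [sndCoord, sub_re, sub_im]; ring

theorem norm_sq_eq_coord (z : ℂ) : ‖z‖ ^ 2 = 2 * (fstCoord z ^ 2 + sndCoord z ^ 2) := by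
  rw [← Complex.normSq_eq_norm_sq, normSq_apply, fstCoord, sndCoord]; ring

theorem coord_sq_eq_zero_iff (z : ℂ) : fstCoord z ^ 2 + sndCoord z ^ 2 = 0 ↔ z = 0 := by
  rw [← norm_eq_zero (a := z), ← sq_eq_zero_iff (a := ‖z‖), norm_sq_eq_coord]
  constructor <;> intro h <;> linarith

theorem coord_sq_pos {z : ℂ} (hz : z ≠ 0) : 0 < fstCoord z ^ 2 + sndCoord z ^ 2 :=
  lt_of_le_of_ne (by positivity) fun h => hz ((coord_sq_eq_zero_iff z).1 h.symm)

theorem fstCoord_inv (z : ℂ) : fstCoord (-1 / z) =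
    -sndCoord z / (2 * (fstCoord z ^ 2 + sndCoord z ^ 2)) := by
  rw [← norm_sq_eq_coord, ← Complex.normSq_eq_norm_sq]
  simp [fstCoord, sndCoord, neg_div]
  ring

theorem sndCoord_inv (z : ℂ) : sndCoord (-1 / z) =
    -fstCoord z / (2 * (fstCoord z ^ 2 + sndCoord z ^ 2)) := by
  rw [← norm_sq_eq_coord, ← Complex.normSq_eq_norm_sq]
  simp [fstCoord, sndCoord, neg_div]
  ring

theorem fstCoord_I_mul (z : ℂ) : fstCoord (I * z) = sndCoord z := by
  simp [fstCoord, sndCoord]; ring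

theorem sndCoord_I_mul (z : ℂ) : sndCoord (I * z) = -fstCoord z := by
  simp [fstCoord, sndCoord]; ring

/-- The lattice point `m (1 + i) + n (1 - i)`. -/
def latticePoint (m n : ℤ) : GaussianInt := (m : GaussianInt) * ⟨1, 1⟩ + (n : GaussianInt) * ⟨1, -1⟩

theorem nearestEven_eq (z : ℂ) :
    nearestEven z = latticePoint ⌊fstCoord z + 1 / 2⌋ ⌊sndCoord z + 1 / 2⌋ := by
  simp only [nearestEven, latticePoint, fstCoord, sndCoord]
  congr 4 <;> ring_nf

@[simp] theorem fstCoord_latticePoint (m n : ℤ) : fstCoord (latticePoint m n : ℂ) = m := by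
  simp [fstCoord, latticePoint, GaussianInt.toComplex_def']
  ring

@[simp] theorem sndCoord_latticePoint (m n : ℤ) : sndCoord (latticePoint m n : ℂ) = n := by
  simp [sndCoord, latticePoint, GaussianInt.toComplex_def']

theorem floor_add_half_eq {s : ℝ} {m : ℤ} (h1 : s < 1 / 2) (h2 : -s < 1 / 2) :
    ⌊s + m + 1 / 2⌋ = m := by
  rw [Int.floor_eq_iff]
  constructor <;> linarith

theorem continuous_fstCoord : Continuous fstCoord := by unfold fstCoord; fun_prop

theorem continuous_sndCoord : Continuous sndCoord := by unfold sndCoord; fun_prop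

/-! ### The sets K_j and L_j in coordinates. -/

theorem fundamentalSet_subset :
    fundamentalSet nearestEven ⊆ {z | (fstCoord z ≤ 1 / 2 ∧ -(1 / 2) ≤ fstCoord z) ∧
      sndCoord z ≤ 1 / 2 ∧ -(1 / 2) ≤ sndCoord z} := by
  have c1 := continuous_fstCoord
  have c2 := continuous_sndCoord
  refine closure_minimal ?_ ?_
  · rintro _ ⟨z, rfl⟩
    simp only [Set.mem_ofPred_eq, nearestEven_eq, fstCoord_sub, sndCoord_sub, fstCoord_latticePoint,
      sndCoord_latticePoint]
    have h1 := Int.floor_le (fstCoord z + 1 / 2)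
    have h2 := Int.lt_floor_add_one (fstCoord z + 1 / 2)
    have h3 := Int.floor_le (sndCoord z + 1 / 2)
    have h4 := Int.lt_floor_add_one (sndCoord z + 1 / 2)
    refine ⟨⟨?_, ?_⟩, ?_, ?_⟩ <;> linarith
  · exact ((isClosed_le c1 continuous_const).inter (isClosed_le continuous_const c1)).inter
      ((isClosed_le c2 continuous_const).inter (isClosed_le continuous_const c2))

/-- Off the side lines the closure adds nothing: it stays in the closed square, and points of the
open square round to 0. -/
theorem mem_fundamentalSet_iff {z : ℂ} (h1 : fstCoord z ≠ 1 / 2) (h2 : -fstCoord z ≠ 1 / 2)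
    (h3 : sndCoord z ≠ 1 / 2) (h4 : -sndCoord z ≠ 1 / 2) :
    z ∈ fundamentalSet nearestEven ↔ fstCoord z < 1 / 2 ∧ -fstCoord z < 1 / 2 ∧
      sndCoord z < 1 / 2 ∧ -sndCoord z < 1 / 2 := by
  constructor
  · intro h
    obtain ⟨⟨a1, a2⟩, a3, a4⟩ := fundamentalSet_subset h
    have := lt_of_le_of_ne a1 h1
    have := lt_of_le_of_ne a2 fun h => h2 (by linarith)
    have := lt_of_le_of_ne a3 h3
    have := lt_of_le_of_ne a4 fun h => h4 (by linarith)
    refine ⟨?_, ?_, ?_, ?_⟩ <;> linarith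
  · rintro ⟨a1, a2, a3, a4⟩
    refine subset_closure ⟨z, ?_⟩
    have e1 := floor_add_half_eq (m := 0) a1 a2
    have e2 := floor_add_half_eq (m := 0) a3 a4
    simp only [Int.cast_zero, add_zero] at e1 e2
    rw [nearestEven_eq, e1, e2]
    simp [latticePoint]

theorem norm_sub_le_inv_sqrt_two_iff (z c : ℂ) : ‖z - c‖ ≤ 1 / √2 ↔
    (fstCoord z - fstCoord c) ^ 2 + (sndCoord z - sndCoord c) ^ 2 ≤ 1 / 4 := by
  rw [← sq_le_sq₀ (norm_nonneg _) (by positivity), norm_sq_eq_coord, fstCoord_sub, sndCoord_sub,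
    div_pow, Real.sq_sqrt zero_le_two]
  constructor <;> intro h <;> linarith

theorem norm_sub_ge_inv_sqrt_two_iff (z c : ℂ) : ‖z - c‖ ≥ 1 / √2 ↔
    1 / 4 ≤ (fstCoord z - fstCoord c) ^ 2 + (sndCoord z - sndCoord c) ^ 2 := by
  rw [ge_iff_le, ← sq_le_sq₀ (by positivity) (norm_nonneg _), norm_sq_eq_coord, fstCoord_sub,
    sndCoord_sub, div_pow, Real.sq_sqrt zero_le_two]
  constructor <;> intro h <;> linarith

theorem coe_mem_B_iff (w c : ℂ) : (w : ExtC) ∈ B c ↔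
    (fstCoord w - fstCoord c) ^ 2 + (sndCoord w - sndCoord c) ^ 2 < 1 / 2 := by
  have : (w : ExtC) ∈ B c ↔ ‖w - c‖ < 1 := by
    simp [B, dist_eq_norm]
  rw [this, ← sq_lt_sq₀ (norm_nonneg _) zero_le_one, norm_sq_eq_coord, fstCoord_sub, sndCoord_sub]
  constructor <;> intro h <;> linarith

theorem mem_K_add_three_iff (z : ℂ) (i : ℕ) : z ∈ K (i + 3) ↔ I * z ∈ K (i + 1) := by
  rw [K]
  constructor
  · rintro ⟨v, hv, rfl⟩
    simpa [← mul_assoc] using hv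
  · intro h
    exact ⟨I * z, h, by simp [← mul_assoc]⟩

theorem coe_mem_L_add_three_iff (w : ℂ) (i : ℕ) :
    (w : ExtC) ∈ L (i + 3) ↔ ((I * w : ℂ) : ExtC) ∈ L (i + 1) := by
  rw [L]
  constructor
  · rintro ⟨v, hv, hvw⟩
    induction v using OnePoint.rec with
    | infty => simp at hvw
    | coe v =>
      simp only [OnePoint.map_some, OnePoint.coe_eq_coe] at hvw
      subst hvw
      simpa [← mul_assoc] using hv
  · intro h
    exact ⟨_, h, by simp [← mul_assoc]⟩

theorem coe_mem_L_one_iff (w : ℂ) : (w : ExtC) ∈ L 1 ↔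
    1 / 2 ≤ fstCoord w ^ 2 + sndCoord w ^ 2 ∧ 1 / 2 ≤ fstCoord w ^ 2 + (sndCoord w + 1) ^ 2 ∧
      1 / 2 ≤ (fstCoord w + 1) ^ 2 + sndCoord w ^ 2 := by
  have h1 : fstCoord (-1 + I) = 0 := by simp [fstCoord]
  have h2 : sndCoord (-1 + I) = -1 := by norm_num [sndCoord]
  have h3 : fstCoord (-1 - I) = -1 := by norm_num [fstCoord]
  have h4 : sndCoord (-1 - I) = 0 := by simp [sndCoord]
  have h5 : fstCoord 0 = 0 := by simp [fstCoord]
  have h6 : sndCoord 0 = 0 := by simp [sndCoord]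
  simp only [L, Set.mem_sdiff, Set.mem_univ, Set.mem_union, coe_mem_B_iff, h1, h2, h3, h4, h5, h6,
    true_and, not_or, not_lt, sub_zero, sub_neg_eq_add, and_assoc]

theorem coe_mem_L_two_iff (w : ℂ) : (w : ExtC) ∈ L 2 ↔
    1 / 2 ≤ fstCoord w ^ 2 + sndCoord w ^ 2 ∧
      1 / 2 ≤ fstCoord w ^ 2 + (sndCoord w + 1) ^ 2 := by
  have h1 : fstCoord (-1 + I) = 0 := by simp [fstCoord]
  have h2 : sndCoord (-1 + I) = -1 := by norm_num [sndCoord]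
  have h5 : fstCoord 0 = 0 := by simp [fstCoord]
  have h6 : sndCoord 0 = 0 := by simp [sndCoord]
  simp only [L, Set.mem_sdiff, Set.mem_univ, Set.mem_union, coe_mem_B_iff, h1, h2, h5, h6,
    true_and, not_or, not_lt, sub_zero, sub_neg_eq_add]

theorem mem_K_one_iff (z : ℂ) : z ∈ K 1 ↔ z ∈ fundamentalSet nearestEven ∧
    fstCoord z ^ 2 + sndCoord z ^ 2 ≤ -sndCoord z ∧
    fstCoord z ^ 2 + sndCoord z ^ 2 ≤ -fstCoord z := by
  have h1 : fstCoord ((-1 + I) / 2) = 0 := by norm_num [fstCoord]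
  have h2 : sndCoord ((-1 + I) / 2) = -(1 / 2) := by norm_num [sndCoord]
  have h3 : fstCoord ((-1 - I) / 2) = -(1 / 2) := by norm_num [fstCoord]
  have h4 : sndCoord ((-1 - I) / 2) = 0 := by simp [sndCoord]
  rw [K, Set.mem_ofPred_eq, norm_sub_le_inv_sqrt_two_iff, norm_sub_le_inv_sqrt_two_iff, h1, h2, h3,
    h4]
  refine and_congr Iff.rfl (and_congr ?_ ?_) <;> constructor <;> intro h <;> linarith

theorem mem_K_two_iff (z : ℂ) : z ∈ K 2 ↔ z ∈ fundamentalSet nearestEven ∧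
    fstCoord z ^ 2 + sndCoord z ^ 2 ≤ -sndCoord z ∧
    -fstCoord z ≤ fstCoord z ^ 2 + sndCoord z ^ 2 ∧
    fstCoord z ≤ fstCoord z ^ 2 + sndCoord z ^ 2 := by
  have h1 : fstCoord ((-1 + I) / 2) = 0 := by norm_num [fstCoord]
  have h2 : sndCoord ((-1 + I) / 2) = -(1 / 2) := by norm_num [sndCoord]
  have h3 : fstCoord ((-1 - I) / 2) = -(1 / 2) := by norm_num [fstCoord]
  have h4 : sndCoord ((-1 - I) / 2) = 0 := by simp [sndCoord]
  have h5 : fstCoord ((1 + I) / 2) = 1 / 2 := by norm_num [fstCoord]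
  have h6 : sndCoord ((1 + I) / 2) = 0 := by simp [sndCoord]
  rw [K, Set.mem_ofPred_eq, norm_sub_le_inv_sqrt_two_iff, norm_sub_ge_inv_sqrt_two_iff,
    norm_sub_ge_inv_sqrt_two_iff, h1, h2, h3, h4, h5, h6]
  refine and_congr Iff.rfl (and_congr ?_ (and_congr ?_ ?_)) <;> constructor <;> intro h <;> linarith

/-- The domain `⋃ K_i × L_i` of the natural extension. -/
def natDomain : Set (ℂ × ExtC) := ⋃ i ∈ Finset.Icc 1 8, K i ×ˢ L i

/-- The point of `ℂ` is generic as a first coordinate. -/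
def FstGenericC (z : ℂ) : Prop := FstGeneric (fstCoord z) (sndCoord z)

/-- The point of `ℂ` is generic as a second coordinate. -/
def SndGenericC (w : ℂ) : Prop := SndGeneric (fstCoord w) (sndCoord w)

/-- The point is off the circles and lines bounding the pieces `K_i`. -/
def FstRegular (s t : ℝ) : Prop :=
  (s ^ 2 + t ^ 2 ≠ s ∧ s ^ 2 + t ^ 2 ≠ -s ∧ s ^ 2 + t ^ 2 ≠ t ∧ s ^ 2 + t ^ 2 ≠ -t) ∧
    s ≠ 1 / 2 ∧ -s ≠ 1 / 2 ∧ t ≠ 1 / 2 ∧ -t ≠ 1 / 2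

/-- The point is off the circles bounding the sets `L_i`. -/
def SndRegular (x y : ℝ) : Prop :=
  x ^ 2 + y ^ 2 ≠ 1 / 2 ∧ (x - 1) ^ 2 + y ^ 2 ≠ 1 / 2 ∧ (x + 1) ^ 2 + y ^ 2 ≠ 1 / 2 ∧
    x ^ 2 + (y - 1) ^ 2 ≠ 1 / 2 ∧ x ^ 2 + (y + 1) ^ 2 ≠ 1 / 2

theorem FstGeneric.add_int {s t : ℝ} (h : FstGeneric s t) (m n : ℤ) :
    FstGeneric (s + m) (t + n) := fun k l => by
  have := h (m + k) (n + l)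
  push_cast at this
  simpa only [add_assoc] using this

theorem SndGeneric.add_int {x y : ℝ} (h : SndGeneric x y) (m n : ℤ) :
    SndGeneric (x + m) (y + n) := fun k l => by
  have := h (m + k) (n + l)
  push_cast at this
  simpa only [add_assoc] using this

theorem FstGeneric.regular {s t : ℝ} (h : FstGeneric s t) : FstRegular s t := by
  obtain ⟨h1, h2, h3, h4, h5, h6⟩ := h 0 0
  obtain ⟨-, -, -, -, h7, h8⟩ := h 1 1
  simp only [Int.cast_zero, add_zero, Int.cast_one] at *
  exact ⟨⟨h1, h2, h3, h4⟩, h5, fun h => h7 (by linarith), h6,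
    fun h => h8 (by linarith)⟩

theorem SndGeneric.regular {x y : ℝ} (h : SndGeneric x y) : SndRegular x y := by
  have h1 := (h 0 0).1
  have h2 := (h (-1) 0).1
  have h3 := (h 1 0).1
  have h4 := (h 0 (-1)).1
  have h5 := (h 0 1).1
  simp only [Int.cast_zero, add_zero, Int.cast_one, Int.cast_neg, ← sub_eq_add_neg] at *
  exact ⟨h1, h2, h3, h4, h5⟩

/-- Genericity is invariant under lattice translation but is not claimed for inverses; regularity,
which is all that the description of Ω needs, survives inversion. -/
theorem FstRegular.inv {s t : ℝ} (hr : 0 < s ^ 2 + t ^ 2) (h : FstRegular s t) :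
    FstRegular (-t / (2 * (s ^ 2 + t ^ 2))) (-s / (2 * (s ^ 2 + t ^ 2))) := by
  obtain ⟨⟨h1, h2, h3, h4⟩, h5, h6, h7, h8⟩ := h
  have e2 : (-t / (2 * (s ^ 2 + t ^ 2))) ^ 2 + (-s / (2 * (s ^ 2 + t ^ 2))) ^ 2 =
      1 / 2 / (2 * (s ^ 2 + t ^ 2)) := by
    field_simp
    ring
  have e3 : ∀ a : ℝ, 1 / 2 / (2 * (s ^ 2 + t ^ 2)) = a / (2 * (s ^ 2 + t ^ 2)) ↔ 1 / 2 = a :=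
    fun a => div_left_inj' (by positivity)
  have e1 : ∀ a : ℝ, a / (2 * (s ^ 2 + t ^ 2)) = 1 / 2 ↔ a = s ^ 2 + t ^ 2 := fun a => by
    rw [div_eq_iff (by positivity)]
    constructor <;> intro h <;> linarith
  unfold FstRegular
  simp only [e2, ne_eq, ← neg_div, e3, e1, neg_neg]
  exact ⟨⟨Ne.symm h8, Ne.symm h7, Ne.symm h6, Ne.symm h5⟩, Ne.symm h4, Ne.symm h3, Ne.symm h2,
    Ne.symm h1⟩

theorem SndRegular.inv {x y : ℝ} (hρ : 0 < x ^ 2 + y ^ 2) (h : SndRegular x y) :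
    SndRegular (-y / (2 * (x ^ 2 + y ^ 2))) (-x / (2 * (x ^ 2 + y ^ 2))) := by
  obtain ⟨h1, h2, h3, h4, h5⟩ := h
  have e5 : ∀ a b : ℝ, ((-y / (2 * (x ^ 2 + y ^ 2)) + a) ^ 2 +
      (-x / (2 * (x ^ 2 + y ^ 2)) + b) ^ 2 = 1 / 2) →
      1 / 4 - a * y - b * x = (1 / 2 - (a ^ 2 + b ^ 2)) * (x ^ 2 + y ^ 2) := fun a b h => by
    have : (-y / (2 * (x ^ 2 + y ^ 2)) + a) ^ 2 + (-x / (2 * (x ^ 2 + y ^ 2)) + b) ^ 2 =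
      (a ^ 2 + b ^ 2) + (1 / 4 - a * y - b * x) / (x ^ 2 + y ^ 2) := by
      field_simp
      ring
    rw [this, ← eq_sub_iff_add_eq', div_eq_iff hρ.ne'] at h
    exact h
  have f0 := e5 0 0
  have f1 := e5 (-1) 0
  have f2 := e5 1 0
  have f3 := e5 0 (-1)
  have f4 := e5 0 1
  simp only [add_zero, ← sub_eq_add_neg] at f0 f1 f2 f3 f4
  exact ⟨fun h => h1 (by linarith [f0 h]), fun h => h5 (by linarith [f1 h]),
    fun h => h4 (by linarith [f2 h]), fun h => h3 (by linarith [f3 h]),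
    fun h => h2 (by linarith [f4 h])⟩

theorem FstRegular.rotate {s t : ℝ} (h : FstRegular s t) : FstRegular t (-s) := by
  obtain ⟨⟨h1, h2, h3, h4⟩, h5, h6, h7, h8⟩ := h
  have e : t ^ 2 + (-s) ^ 2 = s ^ 2 + t ^ 2 := by ring
  unfold FstRegular
  simp only [e, neg_neg]
  exact ⟨⟨h3, h4, h2, h1⟩, h7, h8, h6, h5⟩

/-- The open square of side one about the origin. -/
def InSquare (s t : ℝ) : Prop := s < 1 / 2 ∧ -s < 1 / 2 ∧ t < 1 / 2 ∧ -t < 1 / 2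

theorem inSquare_rotate_iff {s t : ℝ} : InSquare t (-s) ↔ InSquare s t := by
  unfold InSquare
  rw [neg_neg]
  tauto

/-- The piece `K_1` in coordinates, up to boundaries. -/
def OddPiece (s t : ℝ) : Prop := InSquare s t ∧ s ^ 2 + t ^ 2 ≤ -t ∧ s ^ 2 + t ^ 2 ≤ -s

/-- The piece `K_2` in coordinates, up to boundaries. -/
def EvenPiece (s t : ℝ) : Prop :=
  InSquare s t ∧ s ^ 2 + t ^ 2 ≤ -t ∧ -s ≤ s ^ 2 + t ^ 2 ∧ s ≤ s ^ 2 + t ^ 2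

/-- The set `L_1` in coordinates. -/
def OddFibre (x y : ℝ) : Prop :=
  1 / 2 ≤ x ^ 2 + y ^ 2 ∧ 1 / 2 ≤ x ^ 2 + (y + 1) ^ 2 ∧ 1 / 2 ≤ (x + 1) ^ 2 + y ^ 2

/-- The set `L_2` in coordinates. -/
def EvenFibre (x y : ℝ) : Prop := 1 / 2 ≤ x ^ 2 + y ^ 2 ∧ 1 / 2 ≤ x ^ 2 + (y + 1) ^ 2

theorem mem_K_iff {z : ℂ} {s t : ℝ} (hs : fstCoord z = s) (ht : sndCoord z = t)
    (h : FstRegular s t) :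
    (z ∈ K 1 ↔ OddPiece s t) ∧ (z ∈ K 2 ↔ EvenPiece s t) := by
  subst hs ht
  obtain ⟨-, h5, h6, h7, h8⟩ := h
  rw [mem_K_one_iff, mem_K_two_iff, mem_fundamentalSet_iff h5 h6 h7 h8]
  exact ⟨Iff.rfl, Iff.rfl⟩

theorem mem_L_iff {w : ℂ} {x y : ℝ} (hx : fstCoord w = x) (hy : sndCoord w = y) :
    ((w : ExtC) ∈ L 1 ↔ OddFibre x y) ∧ ((w : ExtC) ∈ L 2 ↔ EvenFibre x y) := by
  subst hx hy
  exact ⟨coe_mem_L_one_iff w, coe_mem_L_two_iff w⟩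

/-- Multiplication by i is (s, t) ↦ (t, -s), so the later pieces are the first two evaluated at
rotated points. -/
theorem mem_natDomain_iff_pieces {z w : ℂ} {s t x y : ℝ} (hs : fstCoord z = s)
    (ht : sndCoord z = t) (hx : fstCoord w = x) (hy : sndCoord w = y) (h : FstRegular s t) :
    (z, (w : ExtC)) ∈ natDomain ↔
      (OddPiece s t ∧ OddFibre x y) ∨ (EvenPiece s t ∧ EvenFibre x y) ∨
      (OddPiece t (-s) ∧ OddFibre y (-x)) ∨ (EvenPiece t (-s) ∧ EvenFibre y (-x)) ∨
      (OddPiece (-s) (-t) ∧ OddFibre (-x) (-y)) ∨ (EvenPiece (-s) (-t) ∧ EvenFibre (-x) (-y)) ∨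
      (OddPiece (-t) s ∧ OddFibre (-y) x) ∨ (EvenPiece (-t) s ∧ EvenFibre (-y) x) := by
  have k1 := mem_K_iff hs ht h
  have k2 := mem_K_iff (z := I * z) (by rw [fstCoord_I_mul, ht]) (by rw [sndCoord_I_mul, hs])
    h.rotate
  have k3 := mem_K_iff (z := I * (I * z)) (by rw [fstCoord_I_mul, sndCoord_I_mul, hs])
    (by rw [sndCoord_I_mul, fstCoord_I_mul, ht]) h.rotate.rotate
  have k4 := mem_K_iff (z := I * (I * (I * z)))
    (by rw [fstCoord_I_mul, sndCoord_I_mul, fstCoord_I_mul, ht])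
    (by rw [sndCoord_I_mul, fstCoord_I_mul, sndCoord_I_mul, hs]) h.rotate.rotate.rotate
  have l1 := mem_L_iff hx hy
  have l2 := mem_L_iff (w := I * w) (by rw [fstCoord_I_mul, hy]) (by rw [sndCoord_I_mul, hx])
  have l3 := mem_L_iff (w := I * (I * w)) (by rw [fstCoord_I_mul, sndCoord_I_mul, hx])
    (by rw [sndCoord_I_mul, fstCoord_I_mul, hy])
  have l4 := mem_L_iff (w := I * (I * (I * w)))
    (by rw [fstCoord_I_mul, sndCoord_I_mul, fstCoord_I_mul, hy])
    (by rw [sndCoord_I_mul, fstCoord_I_mul, sndCoord_I_mul, hx])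
  rw [neg_neg] at k4 l4
  simp only [← mem_K_add_three_iff, ← coe_mem_L_add_three_iff, Nat.reduceAdd] at k2 k3 k4 l2 l3 l4
  refine Iff.trans ?_ ((k1.1.and l1.1).or <| (k1.2.and l1.2).or <| (k2.1.and l2.1).or <|
    (k2.2.and l2.2).or <| (k3.1.and l3.1).or <| (k3.2.and l3.2).or <| (k4.1.and l4.1).or <|
    k4.2.and l4.2)
  simp only [natDomain, Set.mem_iUnion, Set.mem_prod, Finset.mem_Icc, exists_prop]
  constructor
  · rintro ⟨i, ⟨h1, h2⟩, hi⟩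
    interval_cases i <;> simp only [hi, true_or, or_true, true_and]
  · rintro (h | h | h | h | h | h | h | h)
    exacts [⟨1, by norm_num, h⟩, ⟨2, by norm_num, h⟩, ⟨3, by norm_num, h⟩, ⟨4, by norm_num, h⟩,
      ⟨5, by norm_num, h⟩, ⟨6, by norm_num, h⟩, ⟨7, by norm_num, h⟩, ⟨8, by norm_num, h⟩]

/-- Here r = s² + t². Opposite side disks are disjoint and the four cover the square, so off the
circles z lies in exactly one disk (even pieces) or in two adjacent ones (odd pieces): eight
patterns, one per piece. -/
theorem pieces_iff_implications {r s t : ℝ} {Q A₀ A₁ A₂ A₃ A₄ : Prop} (hr : 0 ≤ r)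
    (hrst : (r ≠ s ∧ r ≠ -s) ∧ r ≠ t ∧ r ≠ -t)
    (hQ : Q → s < r → -s < r → t < r → -t < r → False) :
    (((Q ∧ r ≤ -t ∧ r ≤ -s) ∧ A₀ ∧ A₄ ∧ A₂) ∨ ((Q ∧ r ≤ -t ∧ -s ≤ r ∧ s ≤ r) ∧ A₀ ∧ A₄) ∨
      ((Q ∧ r ≤ s ∧ r ≤ -t) ∧ A₀ ∧ A₁ ∧ A₄) ∨ ((Q ∧ r ≤ s ∧ -t ≤ r ∧ t ≤ r) ∧ A₀ ∧ A₁) ∨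
      ((Q ∧ r ≤ t ∧ r ≤ s) ∧ A₀ ∧ A₃ ∧ A₁) ∨ ((Q ∧ r ≤ t ∧ s ≤ r ∧ -s ≤ r) ∧ A₀ ∧ A₃) ∨
      ((Q ∧ r ≤ -s ∧ r ≤ t) ∧ A₀ ∧ A₂ ∧ A₃) ∨ ((Q ∧ r ≤ -s ∧ t ≤ r ∧ -t ≤ r) ∧ A₀ ∧ A₂)) ↔
    Q ∧ A₀ ∧ (r < s → A₁) ∧ (r < -s → A₂) ∧ (r < t → A₃) ∧ (r < -t → A₄) := by
  obtain ⟨⟨r1, r2⟩, r3, r4⟩ := hrst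
  rcases lt_or_gt_of_ne r1 with c1 | c1 <;> rcases lt_or_gt_of_ne r2 with c2 | c2 <;>
    rcases lt_or_gt_of_ne r3 with c3 | c3 <;> rcases lt_or_gt_of_ne r4 with c4 | c4 <;>
    first
    | (exfalso; linarith)
    | (simp only [c1, c2, c3, c4, c1.le, c2.le, c3.le, c4.le, c1.not_ge, c2.not_ge, c3.not_ge,
        c4.not_ge, c1.not_gt, c2.not_gt, c3.not_gt, c4.not_gt, true_and, false_and, and_false,
        and_true, or_false, false_or, true_implies, false_implies] at hQ ⊢ <;>
        tauto)

theorem mem_natDomain_iff {z w : ℂ} (hz : FstRegular (fstCoord z) (sndCoord z))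
    (hw : SndRegular (fstCoord w) (sndCoord w)) : (z, (w : ExtC)) ∈ natDomain ↔
      InnerRegion (fstCoord z) (sndCoord z) (fstCoord w) (sndCoord w) := by
  rw [mem_natDomain_iff_pieces rfl rfl rfl rfl hz]
  generalize fstCoord z = s at *
  generalize sndCoord z = t at *
  generalize fstCoord w = x at *
  generalize sndCoord w = y at *
  have sq2 : InSquare (-s) (-t) ↔ InSquare s t :=
    inSquare_rotate_iff.trans inSquare_rotate_iff
  have sq3 : InSquare (-t) s ↔ InSquare s t := by
    rw [← inSquare_rotate_iff, ← inSquare_rotate_iff, neg_neg, inSquare_rotate_iff]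
  have e1 : t ^ 2 + s ^ 2 = s ^ 2 + t ^ 2 := add_comm _ _
  have e2 : y ^ 2 + x ^ 2 = x ^ 2 + y ^ 2 := add_comm _ _
  have e3 : y ^ 2 + (-x + 1) ^ 2 = (x - 1) ^ 2 + y ^ 2 := by ring
  have e4 : (y + 1) ^ 2 + x ^ 2 = x ^ 2 + (y + 1) ^ 2 := by ring
  have e5 : x ^ 2 + (-y + 1) ^ 2 = x ^ 2 + (y - 1) ^ 2 := by ring
  have e6 : (-x + 1) ^ 2 + y ^ 2 = (x - 1) ^ 2 + y ^ 2 := by ring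
  have e7 : y ^ 2 + (x + 1) ^ 2 = (x + 1) ^ 2 + y ^ 2 := by ring
  have e8 : (-y + 1) ^ 2 + x ^ 2 = x ^ 2 + (y - 1) ^ 2 := by ring
  simp only [OddPiece, EvenPiece, OddFibre, EvenFibre, inSquare_rotate_iff, sq2, sq3, neg_neg,
    neg_sq, e1, e2, e3, e4, e5, e6, e7, e8]
  obtain ⟨⟨r1, r2, r3, r4⟩, -⟩ := hz
  obtain ⟨q0, q1, q2, q3, q4⟩ := hw
  have hr : 0 ≤ s ^ 2 + t ^ 2 := by positivity
  have hsq := false_of_lt_sq_add_sq (s := s) (t := t)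
  unfold InnerRegion
  change _ ↔ InSquare s t ∧ _
  change InSquare s t → _ at hsq
  have n : ∀ {a : ℝ}, a ≠ 1 / 2 → ((1 / 2 ≤ a) ↔ 1 / 2 < a) := fun {a} ha =>
    ⟨fun h => lt_of_le_of_ne h ha.symm, le_of_lt⟩
  rw [n q0, n q1, n q2, n q3, n q4]
  exact pieces_iff_implications hr ⟨⟨r1, r2⟩, r3, r4⟩ hsq

/-! ### Null sets and genericity almost everywhere. -/

theorem volume_coord_circle (a b q : ℝ) :
    volume {z : ℂ | (fstCoord z + a) ^ 2 + (sndCoord z + b) ^ 2 = q} = 0 := by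
  refine measure_mono_null ?_ (Measure.addHaar_sphere volume (⟨-(a + b), -(a - b)⟩ : ℂ) √(2 * q))
  intro z hz
  have h1 : fstCoord ⟨-(a + b), -(a - b)⟩ = -a := by simp only [fstCoord]; ring
  have h2 : sndCoord ⟨-(a + b), -(a - b)⟩ = -b := by simp only [sndCoord]; ring
  rw [mem_sphere_iff_norm, ← hz, ← Real.sqrt_sq (norm_nonneg _), norm_sq_eq_coord, fstCoord_sub,
    sndCoord_sub, h1, h2, sub_neg_eq_add, sub_neg_eq_add]

/-- Inversion is its own inverse, so away from 0 the preimage is the image of a null set under a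
differentiable map. -/
theorem volume_preimage_inv {N : Set ℂ} (hN : volume N = 0) : volume {z : ℂ | -1 / z ∈ N} = 0 := by
  have h1 : volume ((fun z : ℂ => -1 / z) '' (N \ {0})) = 0 := by
    refine addHaar_image_eq_zero_of_differentiableOn_of_addHaar_eq_zero volume ?_
      (measure_mono_null Set.sdiff_subset hN)
    intro z hz
    have hz0 : z ≠ 0 := hz.2
    have : DifferentiableAt ℂ (fun z : ℂ => -1 / z) z :=
      (differentiableAt_const _).div differentiableAt_id hz0
    exact (this.restrictScalars ℝ).differentiableWithinAt
  refine measure_mono_null ?_ (measure_union_null h1 (measure_singleton (0 : ℂ)))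
  intro z hz
  by_cases h : z = 0
  · exact Or.inr h
  · refine Or.inl ⟨-1 / z, ⟨hz, ?_⟩, ?_⟩
    · simp [h]
    · simp

/-- A translation moves the line to s = -1/2, which inversion sends into a circle through 0; circles
are null. -/
theorem volume_fstCoord_line (a : ℝ) : volume {z : ℂ | fstCoord z + a = 1 / 2} = 0 := by
  have h := volume_preimage_inv (volume_coord_circle 0 (-(1 / 2)) (1 / 4))
  refine measure_mono_null ?_
    ((measure_preimage_add_right volume ((2 * (a - 1) : ℝ) : ℂ) _).trans h)
  intro z hz
  have h1 : fstCoord (z + (2 * (a - 1) : ℝ)) = -(1 / 2) := by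
    have : fstCoord z + a = 1 / 2 := hz
    rw [fstCoord_add, fstCoord]
    simp only [fstCoord, ofReal_re, ofReal_im] at this ⊢
    linarith
  have h0 : 0 < fstCoord (z + (2 * (a - 1) : ℝ)) ^ 2 + sndCoord (z + (2 * (a - 1) : ℝ)) ^ 2 := by
    rw [h1]; positivity
  simp only [Set.mem_preimage, Set.mem_ofPred_eq, fstCoord_inv, sndCoord_inv]
  generalize sndCoord (z + (2 * (a - 1) : ℝ)) = y at *
  rw [h1] at h0 ⊢
  field_simp
  ring

theorem volume_sndCoord_line (a : ℝ) : volume {z : ℂ | sndCoord z + a = 1 / 2} = 0 := by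
  have h := volume_preimage_inv (volume_coord_circle (-(1 / 2)) 0 (1 / 4))
  refine measure_mono_null ?_
    ((measure_preimage_add_right volume ((2 * (a - 1) : ℝ) : ℂ) _).trans h)
  intro z hz
  have h1 : sndCoord (z + (2 * (a - 1) : ℝ)) = -(1 / 2) := by
    have : sndCoord z + a = 1 / 2 := hz
    rw [sndCoord_add, sndCoord]
    simp only [sndCoord, ofReal_re, ofReal_im] at this ⊢
    linarith
  have h0 : 0 < fstCoord (z + (2 * (a - 1) : ℝ)) ^ 2 + sndCoord (z + (2 * (a - 1) : ℝ)) ^ 2 := by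
    rw [h1]; positivity
  simp only [Set.mem_preimage, Set.mem_ofPred_eq, fstCoord_inv, sndCoord_inv]
  generalize fstCoord (z + (2 * (a - 1) : ℝ)) = y at *
  rw [h1] at h0 ⊢
  field_simp
  ring

theorem ae_fstGenericC : ∀ᵐ z : ℂ, FstGenericC z := by
  simp only [FstGenericC, FstGeneric, ae_all_iff]
  intro m n
  have circ : ∀ a b q : ℝ, ∀ᵐ z : ℂ, (fstCoord z + a) ^ 2 + (sndCoord z + b) ^ 2 ≠ q :=
    fun a b q => by simpa [ae_iff] using volume_coord_circle a b q
  have l1 : ∀ᵐ z : ℂ, fstCoord z + m ≠ 1 / 2 := by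
    simpa [ae_iff] using volume_fstCoord_line m
  have l2 : ∀ᵐ z : ℂ, sndCoord z + n ≠ 1 / 2 := by
    simpa [ae_iff] using volume_sndCoord_line n
  -- The shifts by 1/2 and the constant 1/4 come from completing the square.
  filter_upwards [circ (m - 1 / 2) n (1 / 4), circ (m + 1 / 2) n (1 / 4), circ m (n - 1 / 2) (1 / 4),
    circ m (n + 1 / 2) (1 / 4), l1, l2] with z h1 h2 h3 h4 h5 h6
  exact ⟨fun h => h1 (by linarith), fun h => h2 (by linarith), fun h => h3 (by linarith),
    fun h => h4 (by linarith), h5, h6⟩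

theorem ae_sndGenericC : ∀ᵐ w : ℂ, SndGenericC w := by
  simp only [SndGenericC, SndGeneric, ae_all_iff]
  intro m n
  have circ : ∀ a b q : ℝ, ∀ᵐ z : ℂ, (fstCoord z + a) ^ 2 + (sndCoord z + b) ^ 2 ≠ q :=
    fun a b q => by simpa [ae_iff] using volume_coord_circle a b q
  filter_upwards [circ m n (1 / 2), circ m n 0] with w h1 h2 using ⟨h1, h2⟩

theorem ae_inv {P : ℂ → Prop} (h : ∀ᵐ z, P z) : ∀ᵐ z : ℂ, P (-1 / z) :=
  volume_preimage_inv (N := {z | ¬P z}) h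

/-! ### The natural extension on generic points. -/

/-- The points of `ℂ × ExtC` with generic finite coordinates. -/
def genericSet : Set (ℂ × ExtC) :=
  {p | FstGenericC p.1 ∧ ∃ w : ℂ, p.2 = w ∧ SndGenericC w}

theorem FstGenericC.add_latticePoint {z : ℂ} (h : FstGenericC z) (m n : ℤ) :
    FstGenericC (z + (latticePoint m n : ℂ)) := by
  unfold FstGenericC
  rw [fstCoord_add, sndCoord_add, fstCoord_latticePoint, sndCoord_latticePoint]
  exact FstGeneric.add_int h m n

theorem SndGenericC.add_latticePoint {z : ℂ} (h : SndGenericC z) (m n : ℤ) :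
    SndGenericC (z + (latticePoint m n : ℂ)) := by
  unfold SndGenericC
  rw [fstCoord_add, sndCoord_add, fstCoord_latticePoint, sndCoord_latticePoint]
  exact SndGeneric.add_int h m n

theorem latticePoint_neg (m n : ℤ) :
    (latticePoint (-m) (-n) : ℂ) = -(latticePoint m n : ℂ) := by
  simp only [latticePoint, ← GaussianInt.toComplex_neg]
  push_cast
  ring_nf

theorem FstGenericC.ne_zero {z : ℂ} (h : FstGenericC z) : z ≠ 0 := by
  rintro rfl
  simpa [fstCoord, sndCoord] using (h 0 0).1

theorem SndGenericC.ne_zero {z : ℂ} (h : SndGenericC z) : z ≠ 0 := by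
  rintro rfl
  simpa [fstCoord, sndCoord] using (h 0 0).2

theorem T_coe (a : GaussianInt) (w : ℂ) : T a (w : ExtC) = ((w + a : ℂ) : ExtC) := rfl

theorem S_coe {w : ℂ} (hw : w ≠ 0) : S (w : ExtC) = ((-1 / w : ℂ) : ExtC) := by
  simp [S, hw]

theorem natExt_coe (ch : ℂ → GaussianInt) {z w : ℂ} (hz : z ≠ 0) (hw : w ≠ 0) :
    natExt ch (z, (w : ExtC)) =
      (-1 / z - (digit ch z : ℂ), ((-1 / w - (digit ch z : ℂ) : ℂ) : ExtC)) := by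
  simp only [natExt, gaussMap, if_neg hz, S_coe hw, T_coe, GaussianInt.toComplex_neg,
    ← sub_eq_add_neg]

/-- A point whose image under the natural extension is generic has finite nonzero coordinates. -/
theorem exists_eq_of_natExt_mem_genericSet {p : ℂ × ExtC}
    (h : natExt nearestEven p ∈ genericSet) :
    ∃ z w : ℂ, z ≠ 0 ∧ w ≠ 0 ∧ p = (z, (w : ExtC)) := by
  obtain ⟨z, v⟩ := p
  obtain ⟨h1, w', h2, h3⟩ := h
  have hz : z ≠ 0 := by
    rintro rfl
    exact h1.ne_zero (by simp [natExt, gaussMap])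
  induction v using OnePoint.rec with
  | infty =>
    exfalso
    simp only [natExt, S, OnePoint.elim_infty, T_coe, OnePoint.coe_eq_coe, digit, nearestEven_eq,
      GaussianInt.toComplex_neg] at h2
    -- Since S ∞ = 0, the second image coordinate is -a; translating back by a gives 0, which is not
    -- generic.
    have := h3.add_latticePoint ⌊fstCoord (-1 / z) + 1 / 2⌋ ⌊sndCoord (-1 / z) + 1 / 2⌋
    exact this.ne_zero (by rw [← h2]; ring)
  | coe w =>
    refine ⟨z, w, hz, ?_, rfl⟩
    rintro rfl
    simp [natExt, S, T] at h2

theorem neg_one_div_neg_one_div (z : ℂ) : -1 / (-1 / z) = z := by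
  simp

theorem mem_natDomain_iff_outerRegion {u v : ℂ} (hu : FstGenericC u) (hv : SndGenericC v) :
    (-1 / u, ((-1 / v : ℂ) : ExtC)) ∈ natDomain ↔
      OuterRegion (fstCoord u) (sndCoord u) (fstCoord v) (sndCoord v) := by
  have h1 := coord_sq_pos hu.ne_zero
  have h2 := coord_sq_pos hv.ne_zero
  rw [mem_natDomain_iff, fstCoord_inv, sndCoord_inv, fstCoord_inv, sndCoord_inv,
    innerRegion_inv_iff h1 h2]
  · rw [fstCoord_inv, sndCoord_inv]
    exact FstRegular.inv h1 (FstGeneric.regular hu)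
  · rw [fstCoord_inv, sndCoord_inv]
    exact SndRegular.inv h2 (SndGeneric.regular hv)

theorem mem_natDomain_iff_innerRegion {z w : ℂ} (hz : FstGenericC z) (hw : SndGenericC w) :
    (z, (w : ExtC)) ∈ natDomain ↔
      InnerRegion (fstCoord z) (sndCoord z) (fstCoord w) (sndCoord w) :=
  mem_natDomain_iff (FstGeneric.regular hz) (SndGeneric.regular hw)

/-- The preimages in the domain of a generic point `(z, w)` are the points
`(-1/(z + a), -1/(w + a))` with `(z + a, w + a)` in the outer region. -/
theorem exists_eq_inv_of_natExt_mem {p : ℂ × ExtC} (hp : p ∈ natDomain)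
    (h : natExt nearestEven p ∈ genericSet) :
    ∃ (z w : ℂ) (m n : ℤ), natExt nearestEven p = (z, (w : ExtC)) ∧ FstGenericC z ∧
      SndGenericC w ∧ InSquare (fstCoord z) (sndCoord z) ∧
      OuterRegion (fstCoord z + m) (sndCoord z + n) (fstCoord w + m) (sndCoord w + n) ∧
      p = (-1 / (z + (latticePoint m n : ℂ)),
        ((-1 / (w + (latticePoint m n : ℂ)) : ℂ) : ExtC)) := by
  obtain ⟨z, w, hz, hw, rfl⟩ := exists_eq_of_natExt_mem_genericSet h
  rw [natExt_coe _ hz hw, digit, nearestEven_eq] at h ⊢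
  obtain ⟨h1, w', h2, h3⟩ := h
  simp only [OnePoint.coe_eq_coe] at h1 h2
  subst h2
  set m := ⌊fstCoord (-1 / z) + 1 / 2⌋ with hm
  set n := ⌊sndCoord (-1 / z) + 1 / 2⌋ with hn
  refine ⟨_, _, m, n, rfl, h1, h3, ?_, ?_, ?_⟩
  · obtain ⟨-, g1, g2, g3, g4⟩ := FstGeneric.regular h1
    rw [fstCoord_sub, fstCoord_latticePoint] at g1 g2
    rw [sndCoord_sub, sndCoord_latticePoint] at g3 g4
    rw [fstCoord_sub, sndCoord_sub, fstCoord_latticePoint, sndCoord_latticePoint]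
    have f1 := Int.floor_le (fstCoord (-1 / z) + 1 / 2)
    have f2 := Int.lt_floor_add_one (fstCoord (-1 / z) + 1 / 2)
    have f3 := Int.floor_le (sndCoord (-1 / z) + 1 / 2)
    have f4 := Int.lt_floor_add_one (sndCoord (-1 / z) + 1 / 2)
    rw [← hm] at f1 f2
    rw [← hn] at f3 f4
    -- The floor gives a half-open square; genericity removes the lower sides.
    exact ⟨by linarith, lt_of_le_of_ne (by linarith) g2, by linarith,
      lt_of_le_of_ne (by linarith) g4⟩
  · have g1 := h1.add_latticePoint m n
    have g3 := h3.add_latticePoint m n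
    have key := mem_natDomain_iff_outerRegion g1 g3
    rw [fstCoord_add, sndCoord_add, fstCoord_add, sndCoord_add, fstCoord_latticePoint,
      sndCoord_latticePoint] at key
    rw [← key, sub_add_cancel, sub_add_cancel, neg_one_div_neg_one_div, neg_one_div_neg_one_div]
    exact hp
  · rw [sub_add_cancel, sub_add_cancel, neg_one_div_neg_one_div, neg_one_div_neg_one_div]

/-- As z is in the open square, the digit of S(z + a) is exactly a. -/
theorem natExt_inv_add_latticePoint {z w : ℂ} {m n : ℤ} (hz : FstGenericC z) (hw : SndGenericC w)
    (h : InSquare (fstCoord z) (sndCoord z)) :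
    natExt nearestEven (-1 / (z + (latticePoint m n : ℂ)),
      ((-1 / (w + (latticePoint m n : ℂ)) : ℂ) : ExtC)) = (z, (w : ExtC)) := by
  have h1 := (hz.add_latticePoint m n).ne_zero
  have h2 := (hw.add_latticePoint m n).ne_zero
  obtain ⟨a1, a2, a3, a4⟩ := h
  rw [natExt_coe _ (by simpa using h1) (by simpa using h2), digit, neg_one_div_neg_one_div,
    neg_one_div_neg_one_div, nearestEven_eq, fstCoord_add, sndCoord_add, fstCoord_latticePoint,
    sndCoord_latticePoint, floor_add_half_eq a1 a2, floor_add_half_eq a3 a4, add_sub_cancel_right,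
    add_sub_cancel_right]

theorem isNull_of_subset {N : Set (ℂ × ExtC)} {P Q : ℂ → Prop} (hP : ∀ᵐ z, P z)
    (hQ : ∀ᵐ w, Q w) (h : ∀ z w : ℂ, P z → Q w → (z, (w : ExtC)) ∉ N) : IsNull N := by
  have h1 : ∀ᵐ p : ℂ × ℂ, P p.1 := Measure.quasiMeasurePreserving_fst.ae hP
  have h2 : ∀ᵐ p : ℂ × ℂ, Q p.2 := Measure.quasiMeasurePreserving_snd.ae hQ
  have : ∀ᵐ p : ℂ × ℂ, (p.1, (p.2 : ExtC)) ∉ N := by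
    filter_upwards [h1, h2] with p hp hq using h _ _ hp hq
  simp only [ae_iff, not_not] at this
  exact this

theorem natExt_mem_genericSet {z w : ℂ} (hz : z ≠ 0) (hw : w ≠ 0) (h1 : FstGenericC (-1 / z))
    (h2 : SndGenericC (-1 / w)) : natExt nearestEven (z, (w : ExtC)) ∈ genericSet := by
  rw [natExt_coe _ hz hw, digit, nearestEven_eq, sub_eq_add_neg, sub_eq_add_neg,
    ← latticePoint_neg]
  exact ⟨h1.add_latticePoint _ _, _, rfl, h2.add_latticePoint _ _⟩

/-- Genericity is imposed on the image on both sides, so the three clauses are precisely the three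
facts about outer translates. -/
theorem bijOn_natExt : Set.BijOn (natExt nearestEven)
    (natDomain ∩ natExt nearestEven ⁻¹' genericSet) (natDomain ∩ genericSet) := by
  refine ⟨?_, ?_, ?_⟩
  · rintro p ⟨hp, hG⟩
    refine ⟨?_, hG⟩
    obtain ⟨z, w, m, n, h, hz, hw, hsq, ho, -⟩ := exists_eq_inv_of_natExt_mem hp hG
    rw [h, mem_natDomain_iff_innerRegion hz hw]
    exact ho.innerRegion hsq
  · rintro p ⟨hp, hG⟩ p' ⟨hp', hG'⟩ hpp
    obtain ⟨z, w, m, n, h, hz, hw, hsq, ho, rfl⟩ := exists_eq_inv_of_natExt_mem hp hG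
    obtain ⟨z', w', m', n', h', -, -, -, ho', rfl⟩ := exists_eq_inv_of_natExt_mem hp' hG'
    rw [h, h', Prod.mk.injEq, OnePoint.coe_eq_coe] at hpp
    obtain ⟨rfl, rfl⟩ := hpp
    obtain ⟨rfl, rfl⟩ := ho.int_unique hsq ho'
    rfl
  · rintro ⟨z, v⟩ ⟨hp, hz, w, hv, hw⟩
    obtain rfl : v = w := hv
    have hI := (mem_natDomain_iff_innerRegion hz hw).1 hp
    obtain ⟨m, n, ho⟩ := hI.exists_outerRegion hz hw
    have key := mem_natDomain_iff_outerRegion (hz.add_latticePoint m n) (hw.add_latticePoint m n)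
    rw [fstCoord_add, sndCoord_add, fstCoord_add, sndCoord_add, fstCoord_latticePoint,
      sndCoord_latticePoint] at key
    have hF := natExt_inv_add_latticePoint (m := m) (n := n) hz hw hI.1
    refine ⟨_, ⟨key.2 ho, ?_⟩, hF⟩
    rw [Set.mem_preimage, hF]
    exact ⟨hz, w, rfl, hw⟩

theorem bijectiveAEOn_natExt : BijectiveAEOn (natExt nearestEven) natDomain := by
  refine ⟨_, _, Set.inter_subset_left, Set.inter_subset_left, ?_, ?_, bijOn_natExt⟩
  · have h0 : ∀ᵐ z : ℂ, z ≠ 0 := by simp [ae_iff]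
    -- Genericity of the image only needs S z and S w to be generic, because the digit is a lattice
    -- point.
    refine isNull_of_subset (h0.and (ae_inv ae_fstGenericC)) (h0.and (ae_inv ae_sndGenericC)) ?_
    rintro z w ⟨hz, hz'⟩ ⟨hw, hw'⟩ ⟨h1, h2⟩
    exact h2 ⟨h1, natExt_mem_genericSet hz hw hz' hw'⟩
  · refine isNull_of_subset ae_fstGenericC ae_sndGenericC ?_
    rintro z w hz hw ⟨h1, h2⟩
    exact h2 ⟨h1, hz, w, rfl, hw⟩

end
end ComplexCF

theorem mainTheorem2 :
    ComplexCF.BijectiveAEOn (ComplexCF.natExt ComplexCF.nearestEven)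
      (⋃ i ∈ Finset.Icc 1 8, ComplexCF.K i ×ˢ ComplexCF.L i) :=
  ComplexCF.bijectiveAEOn_natExt
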